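/- **Conventions.** $B(x,r)$ denotes the closed ball with centre $x$ and radius $r$, and $|\cdot|$ the diameter. A compact subset $A$ of a metric space is *homogeneous* if $|A|>0$ and there is a Borel probability measure $\mu$ supported on $A$ such that, for some constants $\lambda_A\ge 1$, $\kappa_A\in(0,1)$ and $1<\delta_A\le\Delta_A<\infty$, $$\lambda_A^{-1}\le\frac{\mu(B(x_1,r))}{\mu(B(x_2,r))}\le\lambda_A\qquad\text{and}\qquad \delta_A\le\frac{\mu(B(x,r))}{\mu(B(x,\kappa_A r))}\le\Delta_A$$ for all $x_1,x_2,x\in A$ and $0<r\le|A|$. For such an $A$, $\alpha_A$ denotes any real function of small $r>0$ for which there are a measure $\mu$ as above and a point $x\in A$ with $$\left|\alpha_A(r)-\frac{\log\mu(B(x,r))}{\log r}\right|=O\!\left(\frac1{|\log r|}\right)\qquad(r\to0^+).$$ For homogeneous sets $A$ and $B$, possibly in different metric spaces, put $$\chi(A,B)=\limsup_{r\to0^+}\left|\log\frac{\alpha_A(r)}{\alpha_B(r)}\right|\in[0,\infty].$$ $\dim_H$ is the Hausdorff dimension, and $\dim_P$ is the radius packing dimension: for a metric space $Z$ and $s\ge0$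 let $$P^s_0(E)=\lim_{\eta\to0^+}\ \sup\Big\{\sum_i(2r_i)^s\Big\}\quad(E\subseteq Z),$$ the supremum being over families of pairwise disjoint closed balls $B(x_i,r_i)$ of $Z$ with $x_i\in E$ and $0<r_i\le\eta$; let $P^s(E)=\inf\{\sum_{i\in\mathbb N} P^s_0(E_i):E\subseteq\bigcup_{i\in\mathbb N} E_i\}$ and $\dim_P Z=\sup\{s\ge 0:P^s(Z)=\infty\}$ (with $\sup\varnothing=0$); $\dim_P A$ is that of the metric space $A$. **Proposition.** Let $A$ be a homogeneous set. Then $\dim_HA$ and $\dim_PA$ are finite, and for every $\varepsilon>0$ there exists $\delta>0$ such that for every homogeneous set $B$ (in any metric space) and every choice of the functions $\alpha_A$, $\alpha_B$ with $\chi(A,B)<\delta$, the dimensions $\dim_HB$ and $\dim_PB$ are finite and $$|\dim_PA-\dim_PB|<\varepsilon\qquad\text{and}\qquad|\dim_HA-\dim_HB|<\varepsilon .$$ -/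

import Mathlib

open Set Filter Topology MeasureTheory
open scoped NNReal ENNReal

universe u v

/-- `μ` is a Borel probability measure supported on `A` which witnesses that `A` is homogeneous:
closed balls centred in `A` of equal radius have comparable measure, and the ratio
`μ(B(x,r)) / μ(B(x,κr))` stays between two constants `1 < δ ≤ Δ < ∞`, for all `0 < r ≤ diam A`.
(The lower bound `1 < δ` makes every denominator positive: a vanishing denominator would give
quotient `0`.) -/
structure IsHomogeneousMeasure {X : Type*} [MetricSpace X] [MeasurableSpace X]
    (A : Set X) (μ : Measure X) : Prop where
  isProbabilityMeasure : IsProbabilityMeasure μ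
  supported : μ Aᶜ = 0
  comparable : ∃ lam : ℝ, 1 ≤ lam ∧ ∀ x₁ ∈ A, ∀ x₂ ∈ A, ∀ r : ℝ, 0 < r → r ≤ Metric.diam A →
    lam⁻¹ ≤ μ.real (Metric.closedBall x₁ r) / μ.real (Metric.closedBall x₂ r) ∧
      μ.real (Metric.closedBall x₁ r) / μ.real (Metric.closedBall x₂ r) ≤ lam
  scaling : ∃ κ δ Δ : ℝ, 0 < κ ∧ κ < 1 ∧ 1 < δ ∧ δ ≤ Δ ∧
    ∀ x ∈ A, ∀ r : ℝ, 0 < r → r ≤ Metric.diam A →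
      δ ≤ μ.real (Metric.closedBall x r) / μ.real (Metric.closedBall x (κ * r)) ∧
        μ.real (Metric.closedBall x r) / μ.real (Metric.closedBall x (κ * r)) ≤ Δ

/-- A homogeneous subset of a metric space. -/
structure IsHomogeneous {X : Type*} [MetricSpace X] [MeasurableSpace X] (A : Set X) : Prop where
  isCompact : IsCompact A
  diam_pos : 0 < Metric.diam A
  exists_measure : ∃ μ : Measure X, IsHomogeneousMeasure A μ

/-- `alphaFun μ x r = log μ(B(x,r)) / log r`. -/
noncomputable def alphaFun {X : Type*} [MetricSpace X] [MeasurableSpace X]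
    (μ : Measure X) (x : X) (r : ℝ) : ℝ :=
  Real.log (μ.real (Metric.closedBall x r)) / Real.log r

/-- `α` is one of the functions `α_A(r)`: it differs by `O(1 / |log r|)`, as `r → 0⁺`, from
`r ↦ log μ(B(x,r)) / log r` for some measure `μ` witnessing homogeneity and some `x ∈ A`. -/
def IsAlpha {X : Type*} [MetricSpace X] [MeasurableSpace X] (A : Set X) (α : ℝ → ℝ) : Prop :=
  ∃ μ : Measure X, IsHomogeneousMeasure A μ ∧ ∃ x ∈ A,
    Asymptotics.IsBigO (𝓝[>] (0 : ℝ)) (fun r => alphaFun μ x r - α r)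
      (fun r => |Real.log r|⁻¹)

/-- `χ(A,B) = limsup_{r → 0⁺} |log (α_A(r) / α_B(r))|`, as a function of the chosen
representatives `α = α_A` and `β = α_B`; the limsup is taken in `[0,∞]`. -/
noncomputable def chi (α β : ℝ → ℝ) : ℝ≥0∞ :=
  limsup (fun r : ℝ => ENNReal.ofReal |Real.log (α r / β r)|) (𝓝[>] (0 : ℝ))

/-- A (finite) `δ`-packing of `E`: pairwise disjoint closed balls with centres in `E` and radii in
`(0,δ]`, each given by its pair (centre, radius). -/
def IsBallPacking {X : Type*} [MetricSpace X] (E : Set X) (δ : ℝ) (P : Finset (X × ℝ)) : Prop :=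
  (∀ p ∈ P, p.1 ∈ E ∧ 0 < p.2 ∧ p.2 ≤ δ) ∧
    (P : Set (X × ℝ)).PairwiseDisjoint (fun p => Metric.closedBall p.1 p.2)

/-- The `s`-dimensional radius packing premeasure
`lim_{δ → 0} sup {∑ (2 rᵢ)^s : (B(xᵢ,rᵢ)) a δ-packing of E}`. The supremum over finite packings is
the supremum over countable ones, and the limit of a monotone function is its infimum. -/
noncomputable def packingPremeasure {X : Type*} [MetricSpace X] (s : ℝ≥0) (E : Set X) : ℝ≥0∞ :=
  ⨅ (δ : ℝ) (_ : 0 < δ), ⨆ (P : Finset (X × ℝ)) (_ : IsBallPacking E δ P),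
    ∑ p ∈ P, ENNReal.ofReal (2 * p.2) ^ (s : ℝ)

/-- The `s`-dimensional radius packing measure. -/
noncomputable def packingMeasure {X : Type*} [MetricSpace X] (s : ℝ≥0) (E : Set X) : ℝ≥0∞ :=
  ⨅ (U : ℕ → Set X) (_ : E ⊆ ⋃ i, U i), ∑' i, packingPremeasure s (U i)

/-- The radius packing dimension of the metric space `X`. -/
noncomputable def radiusPackingDim (X : Type*) [MetricSpace X] : ℝ≥0∞ :=
  ⨆ (s : ℝ≥0) (_ : packingMeasure s (univ : Set X) = ∞), (s : ℝ≥0∞)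

/-! For a homogeneous set, all balls of radius `r` centred in it have measure comparable to `r ^
α(r)`, up to an error in the exponent that tends to `0`. Hence the Hausdorff dimension is the lower
limit of `α` at `0` and the packing dimension is the upper limit. The four inequalities are
`IsAlpha.ofReal_le_dimH` (mass distribution), `IsAlpha.dimH_le_ofReal` (economical covers at a
sequence of scales), `IsAlpha.radiusPackingDim_le_ofReal` (disjoint balls have total mass at most
`1`) and `IsAlpha.ofReal_le_radiusPackingDim` (large packings, with Baire's theorem).

If `χ(A,B) < log c`, then near `0` each of `α_A`, `α_B` is at most `c` times the other, so the
dimensions of `A` and `B` also differ by a factor of at most `c`. As the dimensions of `A` are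
finite, `c` close to `1` makes the differences small, uniformly in `B`. -/

lemma exists_finset_separated_cover {X : Type*} [PseudoMetricSpace X] {s : Set X}
    (hs : TotallyBounded s) {r : ℝ} (hr : 0 < r) :
    ∃ F : Finset X, (∀ x ∈ F, x ∈ s) ∧ (∀ x ∈ F, ∀ y ∈ F, x ≠ y → r < dist x y) ∧
      s ⊆ ⋃ x ∈ F, Metric.closedBall x r := by
  lift r to ℝ≥0 using hr.le
  have hr2 : r / 2 ≠ 0 := by
    have : r ≠ 0 := by rintro rfl; simp at hr
    simpa using this
  obtain ⟨N, -, hNf, hN⟩ := Metric.exists_finite_isCover_of_totallyBounded hr2 hs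
  have hp : Metric.packingNumber r s ≠ ⊤ := by
    have h1 := Metric.packingNumber_two_mul_le_externalCoveringNumber (r / 2) s
    rw [mul_div_cancel₀ r (two_ne_zero)] at h1
    exact ne_top_of_le_ne_top hNf.encard_lt_top.ne
      (h1.trans hN.externalCoveringNumber_le_encard)
  have hfin : (Metric.maximalSeparatedSet r s).Finite := by
    rw [← Set.encard_ne_top_iff, Metric.encard_maximalSeparatedSet hp]
    exact hp
  refine ⟨hfin.toFinset, fun x hx => ?_, fun x hx y hy hxy => ?_, ?_⟩
  · exact Metric.maximalSeparatedSet_subset (by simpa using hx)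
  · have : (r : ℝ≥0∞) < edist x y := Metric.isSeparated_maximalSeparatedSet (ε := r) (A := s)
      (by simpa using hx) (by simpa using hy) hxy
    rw [edist_dist, ENNReal.lt_ofReal_iff_toReal_lt (by simp)] at this
    simpa using this
  · simpa using (Metric.isCover_maximalSeparatedSet hp).subset_iUnion_closedBall

/-! ### Measures of balls in a homogeneous set -/

namespace IsHomogeneousMeasure

variable {X : Type*} [MetricSpace X] [MeasurableSpace X] {A : Set X} {μ : Measure X}

lemma measureReal_closedBall_pos (h : IsHomogeneousMeasure A μ) (hD : 0 < Metric.diam A) {x : X}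
    (hx : x ∈ A) {r : ℝ} (hr : 0 < r) : 0 < μ.real (Metric.closedBall x r) := by
  have := h.isProbabilityMeasure
  obtain ⟨κ, δ, Δ, hκ, hκ1, hδ, -, hs⟩ := h.scaling
  have h1 : 0 < μ.real (Metric.closedBall x (min r (Metric.diam A))) := by
    refine lt_of_le_of_ne measureReal_nonneg fun h0 => ?_
    have := (hs x hx _ (lt_min hr hD) (min_le_right _ _)).1
    rw [← h0, zero_div] at this
    linarith
  exact h1.trans_le (measureReal_mono (Metric.closedBall_subset_closedBall (min_le_left _ _)))

lemma exists_measureReal_closedBall_le (h : IsHomogeneousMeasure A μ) (hD : 0 < Metric.diam A) :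
    ∃ lam : ℝ, 0 < lam ∧ ∀ x ∈ A, ∀ y ∈ A, ∀ r : ℝ, 0 < r → r ≤ Metric.diam A →
      μ.real (Metric.closedBall x r) ≤ lam * μ.real (Metric.closedBall y r) := by
  obtain ⟨lam, h1, hl⟩ := h.comparable
  refine ⟨lam, by linarith, fun x hx y hy r hr hrD => ?_⟩
  exact (div_le_iff₀ (h.measureReal_closedBall_pos hD hy hr)).1 (hl x hx y hy r hr hrD).2

lemma measureReal_closedBall_diam (h : IsHomogeneousMeasure A μ) (hA : Bornology.IsBounded A)
    {x : X} (hx : x ∈ A) : μ.real (Metric.closedBall x (Metric.diam A)) = 1 := by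
  have := h.isProbabilityMeasure
  have hsub : A ⊆ Metric.closedBall x (Metric.diam A) :=
    fun y hy => Metric.dist_le_diam_of_mem hA hy hx
  have h0 : μ (Metric.closedBall x (Metric.diam A))ᶜ = 0 :=
    measure_mono_null (compl_subset_compl.2 hsub) h.supported
  rw [Measure.real, measure_of_measure_compl_eq_zero h0, measure_univ, ENNReal.toReal_one]

/-- Iterating the scaling property. -/
lemma exists_pow_bounds (h : IsHomogeneousMeasure A μ) (hD : 0 < Metric.diam A) :
    ∃ κ δ Δ : ℝ, 0 < κ ∧ κ < 1 ∧ 1 < δ ∧ 1 < Δ ∧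
      ∀ x ∈ A, ∀ r : ℝ, 0 < r → r ≤ Metric.diam A → ∀ n : ℕ,
        δ ^ n * μ.real (Metric.closedBall x (κ ^ n * r)) ≤ μ.real (Metric.closedBall x r) ∧
        μ.real (Metric.closedBall x r) ≤ Δ ^ n * μ.real (Metric.closedBall x (κ ^ n * r)) := by
  obtain ⟨κ, δ, Δ, hκ, hκ1, hδ, hδΔ, hs⟩ := h.scaling
  refine ⟨κ, δ, Δ, hκ, hκ1, hδ, by linarith, fun x hx r hr hrD n => ?_⟩
  induction n with
  | zero => simp
  | succ n ih =>
    have hle : κ ^ n * r ≤ Metric.diam A :=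
      (mul_le_of_le_one_left hr.le (pow_le_one₀ hκ.le hκ1.le)).trans hrD
    have hpos : 0 < κ ^ n * r := by positivity
    have hp := h.measureReal_closedBall_pos hD hx (mul_pos hκ hpos)
    obtain ⟨h1, h2⟩ := hs x hx _ hpos hle
    rw [le_div_iff₀ hp] at h1
    rw [div_le_iff₀ hp] at h2
    have he : κ ^ (n + 1) * r = κ * (κ ^ n * r) := by ring
    rw [he, pow_succ, pow_succ, mul_assoc, mul_assoc]
    exact ⟨(mul_le_mul_of_nonneg_left h1 (by positivity)).trans ih.1,
      ih.2.trans (mul_le_mul_of_nonneg_left h2 (pow_nonneg (by linarith) _))⟩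

lemma exists_doubling (h : IsHomogeneousMeasure A μ) (hD : 0 < Metric.diam A) :
    ∃ K : ℝ, 0 < K ∧ ∀ x ∈ A, ∀ r : ℝ, 0 < r → r ≤ Metric.diam A →
      μ.real (Metric.closedBall x r) ≤ K * μ.real (Metric.closedBall x (r / 4)) := by
  have := h.isProbabilityMeasure
  obtain ⟨κ, δ, Δ, hκ, hκ1, -, hΔ, hs⟩ := h.exists_pow_bounds hD
  obtain ⟨n, hn⟩ := exists_pow_lt_of_lt_one (show (0 : ℝ) < 1 / 4 by norm_num) hκ1
  refine ⟨Δ ^ n, by positivity, fun x hx r hr hrD => (hs x hx r hr hrD n).2.trans ?_⟩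
  refine mul_le_mul_of_nonneg_left (measureReal_mono (Metric.closedBall_subset_closedBall ?_))
    (by positivity)
  nlinarith

/-- The measure of balls lies between two powers of the radius. -/
lemma exists_rpow_bounds (h : IsHomogeneousMeasure A μ) (hA : IsCompact A)
    (hD : 0 < Metric.diam A) :
    ∃ c C s t : ℝ, 0 < c ∧ 0 < C ∧ 0 < s ∧ 0 < t ∧
      ∀ x ∈ A, ∀ r : ℝ, 0 < r → r ≤ Metric.diam A →
        c * r ^ s ≤ μ.real (Metric.closedBall x r) ∧
          μ.real (Metric.closedBall x r) ≤ C * r ^ t := by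
  have := h.isProbabilityMeasure
  obtain ⟨κ, δ, Δ, hκ, hκ1, hδ, hΔ, hs⟩ := h.exists_pow_bounds hD
  have hlκ : Real.log κ < 0 := Real.log_neg hκ hκ1
  -- The exponent `log a / log (1/κ)` gives `κ ^ s = a⁻¹`. Placing `r` between `κ ^ (n+1) * D` and
  -- `κ ^ n * D` then costs one factor `κ`, which goes into the constants.
  have key : ∀ a : ℝ, 1 < a → ∃ s : ℝ, 0 < s ∧ ∀ n : ℕ, (κ ^ n) ^ s * a ^ n = 1 := by
    intro a ha
    have hla := Real.log_pos ha
    refine ⟨Real.log a / (-Real.log κ), div_pos hla (by linarith), fun n => ?_⟩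
    have hk : κ ^ (Real.log a / (-Real.log κ)) = a⁻¹ := by
      rw [Real.rpow_def_of_pos hκ, ← Real.exp_log (inv_pos.2 (zero_lt_one.trans ha)),
        Real.log_inv]
      congr 1
      rw [div_neg, mul_neg, mul_div_cancel₀ _ hlκ.ne]
    rw [← Real.rpow_natCast κ, ← Real.rpow_mul hκ.le, mul_comm (n : ℝ), Real.rpow_mul hκ.le, hk,
      Real.rpow_natCast, inv_pow]
    exact inv_mul_cancel₀ (pow_pos (by linarith) n).ne'
  obtain ⟨s, hs0, hsn⟩ := key Δ hΔ
  obtain ⟨t, ht0, htn⟩ := key δ hδ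
  set D := Metric.diam A with hDdef
  refine ⟨(κ / D) ^ s, (κ * D)⁻¹ ^ t, s, t, by positivity, by positivity, hs0, ht0,
    fun x hx r hr hrD => ?_⟩
  have hone := h.measureReal_closedBall_diam hA.isBounded hx
  obtain ⟨n, hn1, hn2⟩ := exists_nat_pow_near_of_lt_one (div_pos hr hD)
    ((div_le_one hD).2 hrD) hκ hκ1
  rw [lt_div_iff₀ hD] at hn1
  rw [div_le_iff₀ hD] at hn2
  constructor
  · have h1 := (hs x hx D hD le_rfl (n + 1)).2
    rw [← hDdef] at hone
    rw [hone] at h1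
    have h2 : μ.real (Metric.closedBall x (κ ^ (n + 1) * D)) ≤ μ.real (Metric.closedBall x r) :=
      measureReal_mono (Metric.closedBall_subset_closedBall hn1.le)
    have h3 : (κ / D) ^ s * r ^ s ≤ (κ ^ (n + 1)) ^ s := by
      rw [← Real.mul_rpow (by positivity) hr.le]
      refine Real.rpow_le_rpow (by positivity) ?_ hs0.le
      rw [div_mul_eq_mul_div, div_le_iff₀ hD, pow_succ]
      nlinarith
    refine h3.trans (le_trans ?_ h2)
    have h4 := hsn (n + 1)
    have h5 : 0 < Δ ^ (n + 1) := by positivity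
    have h6 : (0:ℝ) ≤ (κ ^ (n + 1)) ^ s := by positivity
    rw [← h4, mul_comm] at h1
    exact le_of_mul_le_mul_left h1 h5
  · have h1 := (hs x hx D hD le_rfl n).1
    rw [hone] at h1
    have h2 : μ.real (Metric.closedBall x r) ≤ μ.real (Metric.closedBall x (κ ^ n * D)) :=
      measureReal_mono (Metric.closedBall_subset_closedBall hn2)
    have h3 : (κ ^ n) ^ t ≤ (κ * D)⁻¹ ^ t * r ^ t := by
      rw [← Real.mul_rpow (by positivity) hr.le]
      refine Real.rpow_le_rpow (by positivity) ?_ ht0.le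
      rw [inv_mul_eq_div, le_div_iff₀ (by positivity)]
      rw [pow_succ] at hn1
      linarith
    refine h2.trans (le_trans ?_ h3)
    have h4 := htn n
    have h5 : 0 < δ ^ n := by positivity
    rw [← h4, mul_comm ((κ ^ n) ^ t)] at h1
    exact le_of_mul_le_mul_left h1 h5

/-- For `r < 1` the denominator `log r` is negative, so lower bounds on the exponent are upper
bounds on the measure. -/
lemma le_alphaFun_iff (h : IsHomogeneousMeasure A μ) (hD : 0 < Metric.diam A) {x : X}
    (hx : x ∈ A) {r : ℝ} (hr : 0 < r) (hr1 : r < 1) {s : ℝ} :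
    s ≤ alphaFun μ x r ↔ μ.real (Metric.closedBall x r) ≤ r ^ s := by
  rw [alphaFun, le_div_iff_of_neg (Real.log_neg hr hr1), ← Real.log_rpow hr,
    Real.log_le_log_iff (h.measureReal_closedBall_pos hD hx hr) (by positivity)]

lemma alphaFun_le_iff (h : IsHomogeneousMeasure A μ) (hD : 0 < Metric.diam A) {x : X}
    (hx : x ∈ A) {r : ℝ} (hr : 0 < r) (hr1 : r < 1) {s : ℝ} :
    alphaFun μ x r ≤ s ↔ r ^ s ≤ μ.real (Metric.closedBall x r) := by
  rw [alphaFun, div_le_iff_of_neg (Real.log_neg hr hr1), ← Real.log_rpow hr,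
    Real.log_le_log_iff (by positivity) (h.measureReal_closedBall_pos hD hx hr)]

end IsHomogeneousMeasure

/-! ### Behaviour of `α` near zero -/

lemma eventually_nhdsGT_zero_mem_Ioc {a : ℝ} (ha : 0 < a) : ∀ᶠ r : ℝ in 𝓝[>] 0, 0 < r ∧ r ≤ a :=
  Ioc_mem_nhdsGT ha

/-- Any strict loss in the exponent absorbs a multiplicative constant at small scales. -/
lemma eventually_mul_rpow_le {C s t : ℝ} (hst : s < t) :
    ∀ᶠ r : ℝ in 𝓝[>] 0, C * r ^ t ≤ r ^ s := by
  have h1 : Tendsto (fun r : ℝ => C * r ^ (t - s)) (𝓝[>] 0) (𝓝 0) := by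
    have := ((Real.continuousAt_rpow_const 0 (t - s) (Or.inr (by linarith))).tendsto.mono_left
      (nhdsWithin_le_nhds (s := Ioi 0))).const_mul C
    rwa [Real.zero_rpow (by linarith), mul_zero] at this
  filter_upwards [h1.eventually_le_const one_pos, self_mem_nhdsWithin] with r hr hr0
  have hr0 : 0 < r := hr0
  calc C * r ^ t = C * r ^ (t - s) * r ^ s := by
        rw [mul_assoc, ← Real.rpow_add hr0, sub_add_cancel]
    _ ≤ 1 * r ^ s := by gcongr
    _ = r ^ s := one_mul _

namespace IsHomogeneousMeasure

variable {X : Type*} [MetricSpace X] [MeasurableSpace X] {A : Set X} {μ : Measure X}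

lemma exists_eventually_alphaFun_mem (h : IsHomogeneousMeasure A μ) (hA : IsCompact A)
    (hD : 0 < Metric.diam A) {x : X} (hx : x ∈ A) :
    ∃ s S : ℝ, 0 < s ∧ 0 < S ∧ ∀ᶠ r in 𝓝[>] 0, s ≤ alphaFun μ x r ∧ alphaFun μ x r ≤ S := by
  obtain ⟨c, C, s, t, hc, hC, hs, ht, hb⟩ := h.exists_rpow_bounds hA hD
  refine ⟨t / 2, s + 1, by linarith, by linarith, ?_⟩
  filter_upwards [eventually_nhdsGT_zero_mem_Ioc hD,
    eventually_nhdsGT_zero_mem_Ioc (show (0:ℝ) < 1 / 2 by norm_num),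
    eventually_mul_rpow_le (C := C) (show t / 2 < t by linarith),
    eventually_mul_rpow_le (C := c⁻¹) (show s < s + 1 by linarith)] with r hr hr' h1 h2
  rw [h.le_alphaFun_iff hD hx hr.1 (by linarith), h.alphaFun_le_iff hD hx hr.1 (by linarith)]
  refine ⟨(hb x hx r hr.1 hr.2).2.trans h1, le_trans ?_ (hb x hx r hr.1 hr.2).1⟩
  rwa [inv_mul_le_iff₀ hc] at h2

end IsHomogeneousMeasure

namespace IsAlpha

variable {X : Type*} [MetricSpace X] [MeasurableSpace X] {A : Set X} {α : ℝ → ℝ}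

/-- Since `|log r|` tends to infinity, the `O(1/|log r|)` error vanishes in the limit; the dimension
estimates need no more than this. -/
lemma exists_tendsto (h : IsAlpha A α) :
    ∃ μ : Measure X, IsHomogeneousMeasure A μ ∧ ∃ x ∈ A,
      Tendsto (fun r => alphaFun μ x r - α r) (𝓝[>] 0) (𝓝 0) := by
  obtain ⟨μ, hμ, x, hx, ho⟩ := h
  exact ⟨μ, hμ, x, hx, ho.trans_tendsto
    (tendsto_inv_atTop_zero.comp (tendsto_abs_atBot_atTop.comp Real.tendsto_log_nhdsGT_zero))⟩

lemma eventually_pos (h : IsAlpha A α) (hA : IsHomogeneous A) : ∀ᶠ r in 𝓝[>] 0, 0 < α r := by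
  obtain ⟨μ, hμ, x, hx, ho⟩ := h.exists_tendsto
  obtain ⟨s, S, hs, -, hb⟩ := hμ.exists_eventually_alphaFun_mem hA.isCompact hA.diam_pos hx
  filter_upwards [hb, ho.eventually_lt_const hs] with r h1 h2
  linarith

end IsAlpha

lemma IsHomogeneous.nonempty {X : Type*} [MetricSpace X] [MeasurableSpace X] {A : Set X}
    (hA : IsHomogeneous A) : A.Nonempty := by
  by_contra hne
  have := hA.diam_pos
  simp [Set.not_nonempty_iff_eq_empty.1 hne] at this

lemma IsHomogeneous.exists_isAlpha {X : Type*} [MetricSpace X] [MeasurableSpace X] {A : Set X}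
    (hA : IsHomogeneous A) : ∃ (α : ℝ → ℝ) (S : ℝ), IsAlpha A α ∧ 0 < S ∧
      ∀ᶠ r in 𝓝[>] 0, α r ≤ S := by
  obtain ⟨μ, hμ⟩ := hA.exists_measure
  obtain ⟨x, hx⟩ := hA.nonempty
  obtain ⟨s, S, -, hS, hb⟩ := hμ.exists_eventually_alphaFun_mem hA.isCompact hA.diam_pos hx
  exact ⟨alphaFun μ x, S, ⟨μ, hμ, x, hx, by simpa using Asymptotics.isBigO_zero _ _⟩, hS,
    hb.mono fun r hr => hr.2⟩

/-! ### Hausdorff dimension as the lower limit of `α` -/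

section Hausdorff

variable {X : Type*} [MetricSpace X] [MeasurableSpace X] [BorelSpace X] {A : Set X} {α : ℝ → ℝ}

/-- Mass distribution principle. -/
lemma IsAlpha.ofReal_le_dimH (h : IsAlpha A α) (hA : IsHomogeneous A) {s : ℝ}
    (hs : ∀ᶠ r in 𝓝[>] 0, s ≤ α r) : ENNReal.ofReal s ≤ dimH A := by
  obtain ⟨μ, hμ, x₀, hx₀, ho⟩ := h.exists_tendsto
  have := hμ.isProbabilityMeasure
  have hD := hA.diam_pos
  refine le_of_forall_lt_imp_le_of_dense fun b hb => ?_
  obtain ⟨d, hbd, hds⟩ := ENNReal.lt_iff_exists_nnreal_btwn.1 hb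
  refine hbd.le.trans (le_dimH_of_hausdorffMeasure_ne_zero ?_)
  have hd0 : (0 : ℝ) < d := by
    rcases eq_or_ne d 0 with rfl | hd
    · simp at hbd
    · positivity
  have hds' : (d : ℝ) < s := by
    rw [← ENNReal.ofReal_coe_nnreal] at hds
    exact (ENNReal.ofReal_lt_ofReal_iff_of_nonneg d.2).1 hds
  obtain ⟨lam, hlam, hcomp⟩ := hμ.exists_measureReal_closedBall_le hD
  have hev : ∀ᶠ r : ℝ in 𝓝[>] 0, ∀ x ∈ A, μ.real (Metric.closedBall x r) ≤ lam * r ^ (d : ℝ) := by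
    filter_upwards [hs, ho.eventually_const_lt (show (d : ℝ) - s < 0 by linarith),
      eventually_nhdsGT_zero_mem_Ioc hD,
      eventually_nhdsGT_zero_mem_Ioc (show (0:ℝ) < 1 / 2 by norm_num)] with r h1 h2 h3 h4 x hx
    have h5 : μ.real (Metric.closedBall x₀ r) ≤ r ^ (d : ℝ) :=
      (hμ.le_alphaFun_iff hD hx₀ h3.1 (by linarith)).1 (by linarith)
    exact (hcomp x hx x₀ hx₀ r h3.1 h3.2).trans (by gcongr)
  obtain ⟨η, hη0, hη⟩ := mem_nhdsGT_iff_exists_Ioc_subset.1 hev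
  have hη0 : 0 < η := hη0
  have hη1 : ∀ r : ℝ, 0 ≤ r → r ≤ η → ∀ x ∈ A,
      μ (Metric.closedBall x r) ≤ ENNReal.ofReal lam * ENNReal.ofReal r ^ (d : ℝ) := by
    intro r hr hrη x hx
    rcases hr.eq_or_lt with rfl | hr
    -- Radius `0` is needed for test sets of diameter zero: points of `A` carry no mass, by letting
    -- the radius shrink.
    · have hlim : Tendsto (fun r : ℝ => lam * r ^ (d : ℝ)) (𝓝[>] 0) (𝓝 0) := by
        have := ((Real.continuousAt_rpow_const 0 (d : ℝ) (Or.inr hd0.le)).tendsto.mono_left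
          (nhdsWithin_le_nhds (s := Ioi 0))).const_mul lam
        rwa [Real.zero_rpow hd0.ne', mul_zero] at this
      have h0 : μ.real (Metric.closedBall x 0) ≤ 0 := by
        refine ge_of_tendsto hlim ?_
        filter_upwards [hev, self_mem_nhdsWithin] with r hr hr0
        exact (measureReal_mono (Metric.closedBall_subset_closedBall (le_of_lt hr0))).trans
          (hr x hx)
      have h1 : μ.real (Metric.closedBall x 0) = 0 := le_antisymm h0 measureReal_nonneg
      rw [measureReal_eq_zero_iff] at h1
      rw [h1]
      exact zero_le
    · have := hη ⟨hr, hrη⟩ x hx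
      rw [ENNReal.ofReal_rpow_of_pos hr, ← ENNReal.ofReal_mul hlam.le,
        ENNReal.le_ofReal_iff_toReal_le (measure_ne_top _ _) (by positivity)]
      exact this
  -- A small set either misses `A`, and is null, or lies in a ball centred at one of its points in
  -- `A` with its own diameter as radius.
  have hle : (ENNReal.ofReal lam)⁻¹ • μ ≤ μH[(d : ℝ)] := by
    refine Measure.le_hausdorffMeasure _ _ (ENNReal.ofReal η) (by simpa using hη0) fun t ht => ?_
    rw [Measure.smul_apply, smul_eq_mul, ENNReal.inv_mul_le_iff (by simpa using hlam) (by simp)]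
    rcases (t ∩ A).eq_empty_or_nonempty with hem | ⟨x, hxt, hxA⟩
    · rw [measure_mono_null (fun y hy hyA => (hem ▸ (⟨hy, hyA⟩ : y ∈ t ∩ A) : y ∈ (∅ : Set X)))
        hμ.supported]
      exact zero_le
    · have htop : Metric.ediam t ≠ ∞ := ne_top_of_le_ne_top (by simp) ht
      have hsub : t ⊆ Metric.closedBall x (Metric.diam t) := fun y hy =>
        Metric.dist_le_diam_of_mem' htop hy hxt
      have h1 := hη1 (Metric.diam t) Metric.diam_nonneg
        ((ENNReal.le_ofReal_iff_toReal_le htop hη0.le).1 ht) x hxA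
      rw [Metric.diam, ENNReal.ofReal_toReal htop] at h1
      exact (measure_mono hsub).trans h1
  intro h0
  have h1 := hle A
  rw [h0, Measure.smul_apply, smul_eq_mul, nonpos_iff_eq_zero, mul_eq_zero] at h1
  rcases h1 with h1 | h1
  · simp at h1
  · have h2 := measure_univ (μ := μ)
    have h3 : μ univ ≤ μ A + μ Aᶜ := by
      rw [← union_compl_self A]; exact measure_union_le _ _
    rw [h2, h1, hμ.supported] at h3
    simp at h3

/-- The quarter-radius balls around an `r`-separated net are disjoint, and by doubling and
comparability each has at least a fixed fraction of the mass of `B(x₀,r)`; the total mass is at most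
`1`. -/
lemma IsHomogeneousMeasure.exists_finset_cover {μ : Measure X} (hμ : IsHomogeneousMeasure A μ)
    (hA : IsCompact A) (hD : 0 < Metric.diam A) {x₀ : X} (hx₀ : x₀ ∈ A) :
    ∃ K : ℝ, 0 < K ∧ ∀ r : ℝ, 0 < r → r ≤ Metric.diam A → ∃ F : Finset X,
      A ⊆ ⋃ x ∈ F, Metric.closedBall x r ∧
        F.card * μ.real (Metric.closedBall x₀ r) ≤ K := by
  have := hμ.isProbabilityMeasure
  obtain ⟨lam, hlam, hcomp⟩ := hμ.exists_measureReal_closedBall_le hD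
  obtain ⟨K, hK, hdoub⟩ := hμ.exists_doubling hD
  refine ⟨K * lam, by positivity, fun r hr hrD => ?_⟩
  obtain ⟨F, hFA, hFs, hFc⟩ := exists_finset_separated_cover hA.totallyBounded hr
  refine ⟨F, hFc, ?_⟩
  have hdisj : (F : Set X).PairwiseDisjoint (fun x => Metric.closedBall x (r / 4)) := by
    intro x hx y hy hxy
    exact Metric.closedBall_disjoint_closedBall (by have := hFs x hx y hy hxy; linarith)
  calc F.card * μ.real (Metric.closedBall x₀ r)
      = ∑ x ∈ F, μ.real (Metric.closedBall x₀ r) := by simp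
    _ ≤ ∑ x ∈ F, K * lam * μ.real (Metric.closedBall x (r / 4)) := by
        refine Finset.sum_le_sum fun x hx => (hdoub x₀ hx₀ r hr hrD).trans ?_
        rw [mul_assoc]
        exact mul_le_mul_of_nonneg_left
          (hcomp x₀ hx₀ x (hFA x hx) _ (by linarith) (by linarith)) hK.le
    _ = K * lam * μ.real (⋃ x ∈ F, Metric.closedBall x (r / 4)) := by
        rw [← Finset.mul_sum, measureReal_biUnion_finset hdisj
          (fun x _ => measurableSet_closedBall)]
    _ ≤ K * lam * 1 := by gcongr; exact measureReal_le_one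
    _ = K * lam := mul_one _

/-- Hausdorff measure is bounded by the lower limit of the covering sums, so good covers at
arbitrarily small scales suffice. -/
lemma IsAlpha.dimH_le_ofReal (h : IsAlpha A α) (hA : IsHomogeneous A) {s : ℝ} (hs0 : 0 ≤ s)
    (hs : ∃ᶠ r in 𝓝[>] 0, α r ≤ s) : dimH A ≤ ENNReal.ofReal s := by
  obtain ⟨μ, hμ, x₀, hx₀, ho⟩ := h.exists_tendsto
  have hD := hA.diam_pos
  refine le_of_forall_gt_imp_ge_of_dense fun b hb => ?_
  obtain ⟨d, hsd, hdb⟩ := ENNReal.lt_iff_exists_nnreal_btwn.1 hb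
  refine (dimH_le_of_hausdorffMeasure_ne_top ?_).trans hdb.le
  have hsd' : s < (d : ℝ) := by
    rw [← ENNReal.ofReal_coe_nnreal] at hsd
    exact (ENNReal.ofReal_lt_ofReal_iff_of_nonneg hs0).1 hsd
  obtain ⟨K, hK, hcov⟩ := hμ.exists_finset_cover hA.isCompact hD hx₀
  -- The covers must form a family indexed by all real `r`; the empty set is a dummy value outside
  -- the useful range.
  have hcov' : ∀ r : ℝ, ∃ F : Finset X, (0 < r ∧ r ≤ Metric.diam A) →
      A ⊆ ⋃ x ∈ F, Metric.closedBall x r ∧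
        F.card * μ.real (Metric.closedBall x₀ r) ≤ K := by
    intro r
    by_cases hr : 0 < r ∧ r ≤ Metric.diam A
    · obtain ⟨F, hF⟩ := hcov r hr.1 hr.2
      exact ⟨F, fun _ => hF⟩
    · exact ⟨∅, fun h => absurd h hr⟩
  choose F hF using hcov'
  have hballs : ∀ (r : ℝ), 0 < r → ∀ x : X,
      Metric.ediam (Metric.closedBall x r) ≤ ENNReal.ofReal (2 * r) := by
    intro r hr x
    refine Metric.ediam_le fun y hy z hz => ?_
    rw [edist_dist]
    refine ENNReal.ofReal_le_ofReal ?_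
    have := dist_triangle_right y z x
    rw [Metric.mem_closedBall] at hy hz
    linarith
  have key : μH[(d : ℝ)] A ≤ ENNReal.ofReal (2 ^ (d : ℝ) * K) := by
    refine (Measure.hausdorffMeasure_le_liminf_sum (ι := fun r : ℝ => F r) (d : ℝ) A
      (l := 𝓝[>] (0 : ℝ))
      (fun r => ENNReal.ofReal (2 * r)) ?_ (fun r x => Metric.closedBall (x : X) r) ?_ ?_).trans ?_
    · have : Tendsto (fun r : ℝ => ENNReal.ofReal (2 * r)) (𝓝 0) (𝓝 (ENNReal.ofReal (2 * 0))) :=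
        ENNReal.tendsto_ofReal (tendsto_id.const_mul 2)
      rw [mul_zero, ENNReal.ofReal_zero] at this
      exact this.mono_left nhdsWithin_le_nhds
    · filter_upwards [self_mem_nhdsWithin] with r hr x
      exact hballs r hr x
    · filter_upwards [eventually_nhdsGT_zero_mem_Ioc hD] with r hr
      refine (hF r hr).1.trans ?_
      rw [iUnion_subtype]
    · refine liminf_le_of_frequently_le ?_ (by isBoundedDefault)
      refine (hs.and_eventually ((ho.eventually_lt_const (sub_pos.2 hsd')).and
        ((eventually_nhdsGT_zero_mem_Ioc hD).and
        (eventually_nhdsGT_zero_mem_Ioc (show (0:ℝ) < 1 / 2 by norm_num))))).mono ?_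
      rintro r ⟨h1, h2, h3, h4⟩
      have hr := h3.1
      have h5 : r ^ (d : ℝ) ≤ μ.real (Metric.closedBall x₀ r) :=
        (hμ.alphaFun_le_iff hD hx₀ hr (by linarith)).1 (by linarith)
      calc ∑ x : F r, Metric.ediam (Metric.closedBall (x : X) r) ^ (d : ℝ)
          ≤ ∑ x : F r, ENNReal.ofReal (2 * r) ^ (d : ℝ) :=
            Finset.sum_le_sum fun x _ => ENNReal.rpow_le_rpow (hballs r hr x) d.2
        _ = ENNReal.ofReal ((F r).card * (2 * r) ^ (d : ℝ)) := by
            rw [Finset.sum_const, Finset.card_univ, Fintype.card_coe, nsmul_eq_mul,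
              ENNReal.ofReal_rpow_of_pos (by linarith), ENNReal.ofReal_mul (by positivity),
              ENNReal.ofReal_natCast]
        _ ≤ ENNReal.ofReal (2 ^ (d : ℝ) * K) := by
            refine ENNReal.ofReal_le_ofReal ?_
            rw [Real.mul_rpow (by norm_num) hr.le]
            calc (F r).card * (2 ^ (d : ℝ) * r ^ (d : ℝ))
                = 2 ^ (d : ℝ) * ((F r).card * r ^ (d : ℝ)) := by ring
              _ ≤ 2 ^ (d : ℝ) * ((F r).card * μ.real (Metric.closedBall x₀ r)) := by gcongr
              _ ≤ 2 ^ (d : ℝ) * K := by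
                have := (hF r h3).2
                gcongr
  exact ne_top_of_le_ne_top ENNReal.ofReal_ne_top key

end Hausdorff

/-! ### Packing dimension as the upper limit of `α` -/

section Packing

lemma packingPremeasure_empty {X : Type*} [MetricSpace X] (s : ℝ≥0) :
    packingPremeasure s (∅ : Set X) = 0 := by
  refine le_antisymm (iInf₂_le_of_le 1 one_pos (iSup₂_le fun P hP => ?_)) zero_le
  have : P = ∅ := Finset.eq_empty_of_forall_notMem fun p hp => (hP.1 p hp).1
  simp [this]

lemma packingMeasure_univ_le {X : Type*} [MetricSpace X] (s : ℝ≥0) :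
    packingMeasure s (univ : Set X) ≤ packingPremeasure s (univ : Set X) := by
  refine iInf₂_le_of_le (fun n => if n = 0 then univ else ∅)
    (fun x _ => mem_iUnion.2 ⟨0, by simp⟩) ?_
  rw [tsum_eq_single 0 fun n hn => by simp [hn, packingPremeasure_empty]]
  simp

lemma exists_isBallPacking_card {X : Type*} [MetricSpace X] {E : Set X} (hE : TotallyBounded E) {r : ℝ} (hr : 0 < r) :
    ∃ F : Finset X, (∀ δ, r / 4 ≤ δ → IsBallPacking E δ (F ×ˢ {r / 4})) ∧ closure E ⊆ ⋃ x ∈ F, Metric.closedBall x r := by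
  obtain ⟨F, hFE, hFs, hFc⟩ := exists_finset_separated_cover hE hr
  refine ⟨F, fun δ hδ => ⟨fun p hp => ?_, fun p hp q hq hpq => ?_⟩, ?_⟩
  · obtain ⟨x, t⟩ := p
    simp only [Finset.mem_product, Finset.mem_singleton] at hp
    obtain ⟨hx, rfl⟩ := hp
    exact ⟨hFE x hx, by positivity, hδ⟩
  · obtain ⟨x, t⟩ := p
    obtain ⟨y, u⟩ := q
    simp only [Finset.mem_coe, Finset.mem_product, Finset.mem_singleton] at hp hq
    obtain ⟨hx, rfl⟩ := hp
    obtain ⟨hy, rfl⟩ := hq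
    have hxy : x ≠ y := fun h => hpq (by rw [h])
    exact Metric.closedBall_disjoint_closedBall (by have := hFs x hx y hy hxy; linarith)
  · exact closure_minimal hFc
      (F.finite_toSet.isClosed_biUnion fun x _ => Metric.isClosed_closedBall)

variable {X : Type*} [MetricSpace X] [MeasurableSpace X] {A : Set X} {α : ℝ → ℝ}

/-- Balls disjoint in the subspace `A` may overlap in `X`, but only outside `A`, where `μ` vanishes.
-/
lemma IsHomogeneousMeasure.sum_measureReal_le_one [BorelSpace X] {μ : Measure X}
    (hμ : IsHomogeneousMeasure A μ) {P : Finset (A × ℝ)}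
    (hP : (P : Set (A × ℝ)).PairwiseDisjoint (fun p => Metric.closedBall p.1 p.2)) :
    ∑ p ∈ P, μ.real (Metric.closedBall (p.1 : X) p.2) ≤ 1 := by
  have := hμ.isProbabilityMeasure
  have hae : (P : Set (A × ℝ)).Pairwise
      (Function.onFun (AEDisjoint μ) (fun p => Metric.closedBall (p.1 : X) p.2)) := by
    intro p hp q hq hpq
    refine measure_mono_null ?_ hμ.supported
    rintro y ⟨hyp, hyq⟩ hyA
    exact Set.disjoint_left.1 (hP hp hq hpq) (show (⟨y, hyA⟩ : A) ∈ _ from hyp) hyq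
  rw [← measureReal_biUnion_finset₀ hae (fun p _ => measurableSet_closedBall.nullMeasurableSet)]
  exact measureReal_le_one

/-- Radii within one packing vary, so the bound `r ^ d ≤ lam * μ(B(x,r))` is needed at every small
scale; summing it bounds the premeasure. -/
lemma IsAlpha.radiusPackingDim_le_ofReal [BorelSpace X] (h : IsAlpha A α)
    (hA : IsHomogeneous A) {s : ℝ} (hs0 : 0 ≤ s) (hs : ∀ᶠ r in 𝓝[>] 0, α r ≤ s) :
    radiusPackingDim A ≤ ENNReal.ofReal s := by
  obtain ⟨μ, hμ, x₀, hx₀, ho⟩ := h.exists_tendsto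
  have hD := hA.diam_pos
  refine iSup₂_le fun d hd => ?_
  by_contra! hsd
  have hsd' : s < (d : ℝ) := by
    rw [← ENNReal.ofReal_coe_nnreal] at hsd
    exact (ENNReal.ofReal_lt_ofReal_iff_of_nonneg hs0).1 hsd
  obtain ⟨lam, hlam, hcomp⟩ := hμ.exists_measureReal_closedBall_le hD
  have hev : ∀ᶠ r : ℝ in 𝓝[>] 0, ∀ x ∈ A, r ^ (d : ℝ) ≤ lam * μ.real (Metric.closedBall x r) := by
    filter_upwards [hs, ho.eventually_lt_const (sub_pos.2 hsd'),
      eventually_nhdsGT_zero_mem_Ioc hD,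
      eventually_nhdsGT_zero_mem_Ioc (show (0:ℝ) < 1 / 2 by norm_num)] with r h1 h2 h3 h4 x hx
    have h5 : r ^ (d : ℝ) ≤ μ.real (Metric.closedBall x₀ r) :=
      (hμ.alphaFun_le_iff hD hx₀ h3.1 (by linarith)).1 (by linarith)
    exact h5.trans (hcomp x₀ hx₀ x hx r h3.1 h3.2)
  obtain ⟨η, hη0, hη⟩ := mem_nhdsGT_iff_exists_Ioc_subset.1 hev
  have hη0 : 0 < η := hη0
  have hle : packingPremeasure d (univ : Set A) ≤ ENNReal.ofReal (2 ^ (d : ℝ) * lam) := by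
    refine iInf₂_le_of_le η hη0 (iSup₂_le fun P hP => ?_)
    calc ∑ p ∈ P, ENNReal.ofReal (2 * p.2) ^ (d : ℝ)
        = ENNReal.ofReal (∑ p ∈ P, 2 ^ (d : ℝ) * p.2 ^ (d : ℝ)) := by
          rw [ENNReal.ofReal_sum_of_nonneg fun p hp => ?_]
          · refine Finset.sum_congr rfl fun p hp => ?_
            have hp0 := (hP.1 p hp).2.1
            rw [ENNReal.ofReal_rpow_of_pos (by linarith), Real.mul_rpow (by norm_num) hp0.le]
          · have hp0 := (hP.1 p hp).2.1
            positivity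
      _ ≤ ENNReal.ofReal (2 ^ (d : ℝ) * lam) := by
          refine ENNReal.ofReal_le_ofReal ?_
          rw [← Finset.mul_sum]
          refine mul_le_mul_of_nonneg_left ?_ (by positivity)
          calc ∑ p ∈ P, p.2 ^ (d : ℝ)
              ≤ ∑ p ∈ P, lam * μ.real (Metric.closedBall (p.1 : X) p.2) :=
                Finset.sum_le_sum fun p hp => hη (hP.1 p hp).2 p.1 p.1.2
            _ ≤ lam * 1 := by
                rw [← Finset.mul_sum]
                exact mul_le_mul_of_nonneg_left (hμ.sum_measureReal_le_one hP.2) hlam.le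
            _ = lam := mul_one _
  have := (packingMeasure_univ_le d).trans hle
  rw [hd] at this
  exact ENNReal.ofReal_ne_top (top_le_iff.1 this)

/-- `U` is dense in some ball of `A`, so a net of `U` at scale `r` covers a fixed mass `m` and has
at least a multiple of `r ^ (-e)` points. The packing sum is then at least a multiple of `r ^ (d -
e)`, which is unbounded. One good scale below each `δ` is enough. -/
lemma IsAlpha.packingPremeasure_eq_top (h : IsAlpha A α) (hA : IsHomogeneous A) {s : ℝ}
    (hs : ∃ᶠ r in 𝓝[>] 0, s ≤ α r) {d : ℝ≥0} (hd : d < s) {U : Set A}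
    (hU : (interior (closure U)).Nonempty) : packingPremeasure d U = ∞ := by
  obtain ⟨μ, hμ, x₀, hx₀, ho⟩ := h.exists_tendsto
  have := hμ.isProbabilityMeasure
  have hD := hA.diam_pos
  have : CompactSpace A := isCompact_iff_compactSpace.1 hA.isCompact
  obtain ⟨lam, hlam, hcomp⟩ := hμ.exists_measureReal_closedBall_le hD
  obtain ⟨y, hy⟩ := hU
  obtain ⟨ρ, hρ, hball⟩ := Metric.isOpen_iff.1 isOpen_interior y hy
  set E : Set A := Metric.ball y ρ ∩ U with hEdef
  have hEcl : Metric.ball y ρ ⊆ closure E := fun z hz =>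
    Metric.isOpen_ball.inter_closure ⟨hz, interior_subset (hball hz)⟩
  set m := μ.real (Metric.closedBall (y : X) (ρ / 2)) with hm
  have hm0 : 0 < m := hμ.measureReal_closedBall_pos hD y.2 (by linarith)
  -- The gap `s - e` absorbs the error in `α`; the gap `e - d` absorbs the constants.
  obtain ⟨e, hde, hes⟩ := exists_between hd
  refine iInf₂_eq_top.2 fun δ hδ => ENNReal.eq_top_of_forall_nnreal_le fun M => ?_
  have hfreq := hs.and_eventually ((ho.eventually_const_lt (sub_neg.2 hes)).and
    ((eventually_nhdsGT_zero_mem_Ioc hD).and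
    ((eventually_nhdsGT_zero_mem_Ioc (show (0:ℝ) < 1 / 2 by norm_num)).and
    ((eventually_nhdsGT_zero_mem_Ioc hδ).and
    (eventually_mul_rpow_le (C := M * lam * 2 ^ (d : ℝ) / m) hde)))))
  obtain ⟨r, h1, h2, h3, h4, h5, h6⟩ := hfreq.exists
  have hr := h3.1
  have h7 : μ.real (Metric.closedBall x₀ r) ≤ r ^ e :=
    (hμ.le_alphaFun_iff hD hx₀ hr (by linarith)).1 (by linarith)
  obtain ⟨F, hF, hFc⟩ := exists_isBallPacking_card (E := E)
    (isCompact_univ.totallyBounded.subset (subset_univ _)) hr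
  have hP := hF δ (by linarith)
  have hPU : IsBallPacking U δ (F ×ˢ {r / 4}) :=
    ⟨fun p hp => ⟨(hP.1 p hp).1.2, (hP.1 p hp).2⟩, hP.2⟩
  refine le_trans ?_ (le_iSup₂_of_le _ hPU le_rfl)
  have hcard : m ≤ F.card * (lam * r ^ e) := by
    have hsub : Metric.closedBall (y : X) (ρ / 2) ⊆
        (⋃ x ∈ F, Metric.closedBall (x : X) r) ∪ Aᶜ := by
      intro z hz
      by_cases hzA : z ∈ A
      · left
        have hz' : (⟨z, hzA⟩ : A) ∈ Metric.ball y ρ := by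
          have : dist z (y : X) ≤ ρ / 2 := hz
          exact lt_of_le_of_lt this (by linarith)
        have := hFc (hEcl hz')
        simp only [mem_iUnion] at this ⊢
        obtain ⟨x, hx, hxz⟩ := this
        exact ⟨x, hx, hxz⟩
      · exact Or.inr hzA
    calc m ≤ μ.real ((⋃ x ∈ F, Metric.closedBall (x : X) r) ∪ Aᶜ) := measureReal_mono hsub
      _ ≤ μ.real (⋃ x ∈ F, Metric.closedBall (x : X) r) + μ.real Aᶜ := measureReal_union_le _ _
      _ = μ.real (⋃ x ∈ F, Metric.closedBall (x : X) r) := by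
          simp [Measure.real, hμ.supported]
      _ ≤ ∑ x ∈ F, μ.real (Metric.closedBall (x : X) r) := measureReal_biUnion_finset_le _ _
      _ ≤ ∑ x ∈ F, lam * r ^ e := Finset.sum_le_sum fun x _ =>
          (hcomp x x.2 x₀ hx₀ r hr h3.2).trans (by gcongr)
      _ = F.card * (lam * r ^ e) := by simp
  simp only [Finset.sum_product, Finset.sum_singleton, Finset.sum_const, nsmul_eq_mul]
  rw [ENNReal.ofReal_rpow_of_pos (by linarith), ← ENNReal.ofReal_natCast,
    ← ENNReal.ofReal_mul (by positivity), ← ENNReal.ofReal_coe_nnreal]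
  refine ENNReal.ofReal_le_ofReal ?_
  have h8 : (2 * (r / 4)) ^ (d : ℝ) = r ^ (d : ℝ) / 2 ^ (d : ℝ) := by
    rw [← Real.div_rpow hr.le (by norm_num)]
    congr 1
    ring
  rw [h8, ← mul_div_assoc, le_div_iff₀ (by positivity)]
  have hre : 0 < r ^ e := Real.rpow_pos_of_pos hr _
  have h9 : (M : ℝ) * 2 ^ (d : ℝ) * (lam * r ^ e) ≤ F.card * r ^ (d : ℝ) * (lam * r ^ e) := by
    calc (M : ℝ) * 2 ^ (d : ℝ) * (lam * r ^ e)
        = m * (M * lam * 2 ^ (d : ℝ) / m * r ^ e) := by field_simp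
      _ ≤ (F.card * (lam * r ^ e)) * r ^ (d : ℝ) := by gcongr
      _ = F.card * r ^ (d : ℝ) * (lam * r ^ e) := by ring
  exact le_of_mul_le_mul_right h9 (by positivity)

lemma IsAlpha.ofReal_le_radiusPackingDim (h : IsAlpha A α) (hA : IsHomogeneous A) {s : ℝ}
    (hs : ∃ᶠ r in 𝓝[>] 0, s ≤ α r) : ENNReal.ofReal s ≤ radiusPackingDim A := by
  have : CompactSpace A := isCompact_iff_compactSpace.1 hA.isCompact
  have : Nonempty A := hA.nonempty.to_subtype
  refine le_of_forall_lt_imp_le_of_dense fun b hb => ?_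
  obtain ⟨d, hbd, hds⟩ := ENNReal.lt_iff_exists_nnreal_btwn.1 hb
  have hds' : (d : ℝ) < s := by
    rw [← ENNReal.ofReal_coe_nnreal] at hds
    exact (ENNReal.ofReal_lt_ofReal_iff_of_nonneg d.2).1 hds
  refine hbd.le.trans (le_iSup₂_of_le d (iInf₂_eq_top.2 fun U hU => ?_) le_rfl)
  -- Baire's theorem in the compact space `A`: some piece of any countable cover is dense in an open
  -- set.
  obtain ⟨i, hi⟩ := nonempty_interior_of_iUnion_of_closed (f := fun i => closure (U i))
    (fun i => isClosed_closure)
    (univ_subset_iff.1 (hU.trans (iUnion_mono fun i => subset_closure)))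
  have hle : packingPremeasure d (U i) ≤ ∑' i, packingPremeasure d (U i) := ENNReal.le_tsum i
  rw [h.packingPremeasure_eq_top hA hs hds' hi] at hle
  exact top_le_iff.1 hle

end Packing

/-! ### Comparing the dimensions of two sets -/

section Comparison

variable {X : Type*} [MetricSpace X] [MeasurableSpace X] {A : Set X}
  {Y : Type*} [MetricSpace Y] [MeasurableSpace Y] {B : Set Y}
  {α β : ℝ → ℝ}

lemma ENNReal.le_ofReal_mul_of_forall_lt {a b : ℝ≥0∞} {c : ℝ} (hc : 0 < c)
    (h : ∀ t : ℝ, 0 < t → a < ENNReal.ofReal t → b ≤ ENNReal.ofReal (c * t)) :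
    b ≤ ENNReal.ofReal c * a := by
  have hc' : ENNReal.ofReal c ≠ 0 := by simpa using hc
  rw [← ENNReal.div_le_iff' hc' ENNReal.ofReal_ne_top]
  refine le_of_forall_gt_imp_ge_of_dense fun e he => ?_
  obtain ⟨t, hat, hte⟩ := ENNReal.lt_iff_exists_nnreal_btwn.1 he
  have ht : (0 : ℝ) < t := by
    have : t ≠ 0 := by rintro rfl; simp at hat
    positivity
  have := h t ht (by simpa using hat)
  rw [ENNReal.ofReal_mul hc.le, ENNReal.ofReal_coe_nnreal] at this
  exact ((ENNReal.div_le_iff' hc' ENNReal.ofReal_ne_top).2 this).trans hte.le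

/-- If `dimH A < t`, mass distribution forces `α < t` at arbitrarily small scales; there `β ≤ c *
t`, which bounds `dimH B`. The packing version has "eventually" in place of "frequently". -/
lemma IsAlpha.dimH_le_mul [BorelSpace X] [BorelSpace Y] (hα : IsAlpha A α)
    (hA : IsHomogeneous A) (hβ : IsAlpha B β) (hB : IsHomogeneous B) {c : ℝ} (hc : 0 < c) (h : ∀ᶠ r in 𝓝[>] 0, β r ≤ c * α r) :
    dimH B ≤ ENNReal.ofReal c * dimH A := by
  refine ENNReal.le_ofReal_mul_of_forall_lt hc fun t ht hat => ?_
  refine hβ.dimH_le_ofReal hB (by positivity) ?_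
  have h1 : ∃ᶠ r in 𝓝[>] 0, ¬ t ≤ α r := by
    intro h2
    exact absurd (hα.ofReal_le_dimH hA (h2.mono fun r hr => not_not.1 hr)) (not_le.2 hat)
  refine (h1.and_eventually h).mono fun r hr => hr.2.trans ?_
  exact mul_le_mul_of_nonneg_left (not_le.1 hr.1).le hc.le

lemma IsAlpha.radiusPackingDim_le_mul [BorelSpace Y] (hα : IsAlpha A α) (hA : IsHomogeneous A)
    (hβ : IsAlpha B β) (hB : IsHomogeneous B) {c : ℝ} (hc : 0 < c)
    (h : ∀ᶠ r in 𝓝[>] 0, β r ≤ c * α r) :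
    radiusPackingDim B ≤ ENNReal.ofReal c * radiusPackingDim A := by
  refine ENNReal.le_ofReal_mul_of_forall_lt hc fun t ht hat => ?_
  refine hβ.radiusPackingDim_le_ofReal hB (by positivity) ?_
  have h1 : ∀ᶠ r in 𝓝[>] 0, ¬ t ≤ α r := by
    by_contra h2
    exact absurd (hα.ofReal_le_radiusPackingDim hA (not_not.1 fun h3 => h2 (not_frequently.1 h3)))
      (not_le.2 hat)
  filter_upwards [h1, h] with r h1 h2
  exact h2.trans (mul_le_mul_of_nonneg_left (not_le.1 h1).le hc.le)

lemma eventually_le_mul_of_chi_lt {c : ℝ} (hc : 1 < c)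
    (hα : ∀ᶠ r in 𝓝[>] 0, 0 < α r) (hβ : ∀ᶠ r in 𝓝[>] 0, 0 < β r)
    (h : chi α β < ENNReal.ofReal (Real.log c)) :
    ∀ᶠ r in 𝓝[>] 0, α r ≤ c * β r ∧ β r ≤ c * α r := by
  filter_upwards [hα, hβ, eventually_lt_of_limsup_lt h] with r ha hb hr
  have hr := (ENNReal.ofReal_lt_ofReal_iff_of_nonneg (abs_nonneg _)).1 hr
  rw [abs_lt, Real.log_div ha.ne' hb.ne'] at hr
  have hc0 : 0 < c := by linarith
  constructor
  · rw [← Real.log_le_log_iff ha (by positivity), Real.log_mul hc0.ne' hb.ne']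
    linarith
  · rw [← Real.log_le_log_iff hb (by positivity), Real.log_mul hc0.ne' ha.ne']
    linarith

/-- Both differences are at most `(c - 1) * c * a`, a bound free of `b`; this makes the final `δ`
independent of `B`. -/
lemma abs_toReal_sub_toReal_lt {a b : ℝ≥0∞} (ha : a ≠ ∞) {c ε : ℝ} (hc : 1 < c)
    (hab : a ≤ ENNReal.ofReal c * b) (hba : b ≤ ENNReal.ofReal c * a)
    (hε : (c - 1) * c * a.toReal < ε) : b ≠ ∞ ∧ |a.toReal - b.toReal| < ε := by
  have hb : b ≠ ∞ := ne_top_of_le_ne_top (ENNReal.mul_ne_top ENNReal.ofReal_ne_top ha) hba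
  have hab := ENNReal.toReal_mono (ENNReal.mul_ne_top ENNReal.ofReal_ne_top hb) hab
  have hba := ENNReal.toReal_mono (ENNReal.mul_ne_top ENNReal.ofReal_ne_top ha) hba
  rw [ENNReal.toReal_mul, ENNReal.toReal_ofReal (by linarith)] at hab hba
  have ha0 : 0 ≤ a.toReal := ENNReal.toReal_nonneg
  have h1 : (c - 1) * a.toReal ≤ (c - 1) * c * a.toReal := by
    rw [mul_assoc]
    exact mul_le_mul_of_nonneg_left (by nlinarith) (by linarith)
  have h2 : (c - 1) * b.toReal ≤ (c - 1) * c * a.toReal := by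
    rw [mul_assoc]
    exact mul_le_mul_of_nonneg_left hba (by linarith)
  exact ⟨hb, abs_lt.2 ⟨by linarith, by linarith⟩⟩

end Comparison

theorem proposition1p4 {X : Type u} [MetricSpace X] [MeasurableSpace X] [BorelSpace X]
    (A : Set X) (hA : IsHomogeneous A) :
    dimH A ≠ ∞ ∧ radiusPackingDim A ≠ ∞ ∧
    ∀ ε : ℝ, 0 < ε → ∃ δ : ℝ, 0 < δ ∧
      ∀ (Y : Type v) [MetricSpace Y] [MeasurableSpace Y] [BorelSpace Y]
        (B : Set Y), IsHomogeneous B →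
        ∀ α β : ℝ → ℝ, IsAlpha A α → IsAlpha B β → chi α β < ENNReal.ofReal δ →
          dimH B ≠ ∞ ∧ radiusPackingDim B ≠ ∞ ∧
          |(radiusPackingDim A).toReal - (radiusPackingDim B).toReal| < ε ∧
          |(dimH A).toReal - (dimH B).toReal| < ε := by
  obtain ⟨α₀, S, hα₀, hS, hS'⟩ := hA.exists_isAlpha
  have hH : dimH A ≠ ∞ := ne_top_of_le_ne_top ENNReal.ofReal_ne_top
    (hα₀.dimH_le_ofReal hA hS.le hS'.frequently)
  have hP : radiusPackingDim A ≠ ∞ := ne_top_of_le_ne_top ENNReal.ofReal_ne_top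
    (hα₀.radiusPackingDim_le_ofReal hA hS.le hS')
  refine ⟨hH, hP, fun ε hε => ?_⟩
  -- The error bound tends to `0` as `c` decreases to `1`; then `δ = log c`.
  obtain ⟨c, hc, hcH, hcP⟩ : ∃ c : ℝ, 1 < c ∧ (c - 1) * c * (dimH A).toReal < ε ∧
      (c - 1) * c * (radiusPackingDim A).toReal < ε := by
    have key : ∀ M : ℝ, ∀ᶠ c : ℝ in 𝓝[>] 1, (c - 1) * c * M < ε := by
      intro M
      have hcont : ContinuousAt (fun c : ℝ => (c - 1) * c * M) 1 := by fun_prop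
      exact (hcont.eventually_lt_const (by simpa using hε)).filter_mono nhdsWithin_le_nhds
    have hev := (eventually_mem_nhdsWithin (a := (1 : ℝ)) (s := Ioi 1)).and
      ((key (dimH A).toReal).and (key (radiusPackingDim A).toReal))
    exact hev.exists
  refine ⟨Real.log c, Real.log_pos hc, fun Y _ _ _ B hB α β hα hβ hχ => ?_⟩
  have hev := eventually_le_mul_of_chi_lt hc (hα.eventually_pos hA) (hβ.eventually_pos hB) hχ
  have hc0 : 0 < c := by linarith
  have h1 := hev.mono fun r hr => hr.1
  have h2 := hev.mono fun r hr => hr.2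
  obtain ⟨hBH, hBH'⟩ := abs_toReal_sub_toReal_lt hH hc (hβ.dimH_le_mul hB hα hA hc0 h1)
    (hα.dimH_le_mul hA hβ hB hc0 h2) hcH
  obtain ⟨hBP, hBP'⟩ := abs_toReal_sub_toReal_lt hP hc
    (hβ.radiusPackingDim_le_mul hB hα hA hc0 h1)
    (hα.radiusPackingDim_le_mul hA hβ hB hc0 h2) hcP
  exact ⟨hBH, hBP, hBP', hBH'⟩
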